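/- **Setting.** For $k,p\in\mathbb N$ write a data set of size $k$ as $(X,y)\in\mathbb R^{k\times p}\times\{\pm1\}^k$ with rows $x_1,\dots,x_k$ of $X$, and let $l(\beta,(X,y))=\frac1k\sum_{i=1}^k\log(1+\exp(-y_ix_i^\top\beta))$ be the logistic loss. A problem instance $P=(X,y,X_{\rm val},y_{\rm val})$ consists of a training set of size $m\ge1$ and a validation set of size $m'\ge 1$, both with $p$ features. Let $0<\lambda_{\min}\le\lambda_{\max}$, let $R(\beta)=\|\beta\|_1$ or $R(\beta)=\|\beta\|_2^2$, and put, for $\lambda\in[\lambda_{\min},\lambda_{\max}]$, $$\hat\beta_{(X,y)}(\lambda)=\arg\min_{\beta\in\mathbb R^p}\; l(\beta,(X,y))+\lambda R(\beta),\qquad h_\lambda(P)=l(\hat\beta_{(X,y)}(\lambda),(X_{\rm val},y_{\rm val})),$$ $\mathcal H=\{h_\lambda:\lambda\in[\lambda_{\min},\lambda_{\max}]\}$. For a distribution $\mathcal D$ over problem instances the Rademacher complexity is $$\mathscr R_n(\mathcal H)=\mathbb E_{P_1,\dots,P_n\sim\mathcal D}\,\mathbb E_{\sigma}\Big[\sup_{h\in\mathcal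 H}\Big|\frac1n\sum_{i=1}^n\sigma_ih(P_i)\Big|\Big],$$ with $P_1,\dots,P_n$ i.i.d. and $\sigma$ uniform on $\{\pm1\}^n$, independent of them. **Theorem.** Let $0<\lambda_{\min}\le\lambda_{\max}$ and $H\in\mathbb R$. (1) ($\ell_2$ regularization, $R(\beta)=\|\beta\|_2^2$.) There is a constant $C>0$, depending only on $\lambda_{\min},\lambda_{\max},H$, such that for every $B$ there is $\epsilon_0\in(0,1]$ with the following property. Let $m,m'\ge1$ and $p\ge 0$, and let $\mathcal D$ be a probability distribution over problem instances such that almost surely $h_\lambda(P)\le H$ for all $\lambda\in[\lambda_{\min},\lambda_{\max}]$, and every validation feature vector has $\|x\|_2\le B$. Then for all $n\ge1$ and all $0<\epsilon<\epsilon_0$ the random variable inside $\mathbb E_{P_1,\dots,P_n}$ is measurable (up to a null set) and $$\mathscr R_n(\mathcal H)\le C\left(\sqrt{\frac{m^2+\log(1/\epsilon)}{n}}+\epsilon^2\right).$$ (2) ($\ell_1$ regularization, $R(\beta)=\|\beta\|_1$.) There is a constant $C>0$, depending only on $\lambda_{\min},\lambda_{\max},H$, such that for every $B$ and every $\kappa>0$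 there is $\epsilon_0\in(0,1]$ with the following property. Let $m,m'\ge1$ and $p\ge 0$, and let $\mathcal D$ be a probability distribution over problem instances such that almost surely $h_\lambda(P)\le H$ for all $\lambda\in[\lambda_{\min},\lambda_{\max}]$, every validation feature vector has $\|x\|_\infty\le B$, and, for every $\lambda\in[\lambda_{\min},\lambda_{\max}]$, the minimizer $\hat\beta_{(X,y)}(\lambda)$ is unique and the Hessian $\nabla^2 l(\hat\beta_{(X,y)}(\lambda),(X,y))$, restricted to the active coordinates $\{j:\hat\beta_{(X,y)}(\lambda)_j\ne0\}$, has smallest eigenvalue at least $\kappa$. Then the conclusion of (1) holds for all $n\ge1$ and all $0<\epsilon<\epsilon_0$. -/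

import Mathlib

open MeasureTheory
open scoped ENNReal

namespace RegLogistic

/-- A data set of `k` examples with `p` features: the feature vectors and the labels, which lie
in `{1, -1}` (the type `ℤˣ` of integer units). -/
abbrev DataSet (k p : ℕ) : Type := (Fin k → Fin p → ℝ) × (Fin k → ℤˣ)

/-- A problem instance `(X, y, X_val, y_val)`: a training set and a validation set. -/
abbrev Instance (m p m' : ℕ) : Type := DataSet m p × DataSet m' p

/-- The logistic loss `(1/k) ∑ᵢ log (1 + exp (-yᵢ xᵢᵀ β))`. -/
noncomputable def logisticLoss {k p : ℕ} (β : Fin p → ℝ) (S : DataSet k p) : ℝ :=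
  (1 / (k : ℝ)) * ∑ i, Real.log (1 + Real.exp (-(((S.2 i : ℤ) : ℝ) * (S.1 i ⬝ᵥ β))))

/-- The Hessian of `β ↦ logisticLoss β S`, that is, the matrix
`(1/k) ∑ᵢ s(xᵢᵀ β) (1 - s(xᵢᵀ β)) xᵢ xᵢᵀ` with `s` the sigmoid function
(the labels cancel since their squares are `1`). -/
noncomputable def logisticHessian {k p : ℕ} (β : Fin p → ℝ) (S : DataSet k p) :
    Matrix (Fin p) (Fin p) ℝ :=
  Matrix.of fun a b => (1 / (k : ℝ)) *
    ∑ i, Real.sigmoid (S.1 i ⬝ᵥ β) * (1 - Real.sigmoid (S.1 i ⬝ᵥ β)) * S.1 i a * S.1 i b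

/-- The `ℓ₁` penalty `‖β‖₁`. -/
def l1Penalty {p : ℕ} (β : Fin p → ℝ) : ℝ := ∑ j, |β j|

/-- The `ℓ₂` penalty `‖β‖₂²`. -/
def l2Penalty {p : ℕ} (β : Fin p → ℝ) : ℝ := ∑ j, β j ^ 2

/-- `β` minimizes the regularized training loss `l(·, S) + lam * R(·)` over `ℝ^p`. -/
def IsRegMinimizer {k p : ℕ} (R : (Fin p → ℝ) → ℝ) (S : DataSet k p) (lam : ℝ)
    (β : Fin p → ℝ) : Prop :=
  ∀ γ : Fin p → ℝ, logisticLoss β S + lam * R β ≤ logisticLoss γ S + lam * R γ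

/-- The estimator `arg min_β l(β, S) + lam * R(β)`. -/
noncomputable def estimator {k p : ℕ} (R : (Fin p → ℝ) → ℝ) (S : DataSet k p) (lam : ℝ) :
    Fin p → ℝ :=
  Classical.epsilon (IsRegMinimizer R S lam)

/-- The validation loss `h(lam, P)` of the estimator fitted on the training set of `P`. -/
noncomputable def validationLoss {m p m' : ℕ} (R : (Fin p → ℝ) → ℝ) (lam : ℝ)
    (P : Instance m p m') : ℝ :=
  logisticLoss (estimator R P.1 lam) P.2

/-- The validation loss function class `{h(lam, ·) | lam ∈ [lmin, lmax]}`. -/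
def validationLossClass (m p m' : ℕ) (R : (Fin p → ℝ) → ℝ) (lmin lmax : ℝ) :
    Set (Instance m p m' → ℝ) :=
  {h | ∃ lam ∈ Set.Icc lmin lmax, h = validationLoss R lam}

/-- The fit with the `ℓ₁` penalty on the training set `S` is nondegenerate with constant `κ` for
every `lam ∈ [lmin, lmax]`: the minimizer is unique, and the Hessian of the training loss at it,
restricted to the active coordinates (those where the minimizer does not vanish), has all its
eigenvalues at least `κ`. -/
def L1Nondegenerate {k p : ℕ} (S : DataSet k p) (lmin lmax κ : ℝ) : Prop :=
  ∀ lam ∈ Set.Icc lmin lmax,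
    (∃! β, IsRegMinimizer l1Penalty S lam β) ∧
    ∀ β, IsRegMinimizer l1Penalty S lam β →
      ∀ v : Fin p → ℝ, (∀ j, β j = 0 → v j = 0) →
        κ * (v ⬝ᵥ v) ≤ v ⬝ᵥ (logisticHessian β S).mulVec v

/-- The empirical Rademacher complexity `E_σ sup_{f ∈ F} |(1/n) ∑ᵢ σᵢ f(xᵢ)|`, with `σ` uniform
on `{1, -1}^n`, as an element of `[0, ∞]`. -/
noncomputable def empiricalRademacher {X : Type*} {n : ℕ} (F : Set (X → ℝ)) (x : Fin n → X) :
    ℝ≥0∞ :=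
  (∑ σ : Fin n → ℤˣ,
    ⨆ f ∈ F, ENNReal.ofReal |(1 / (n : ℝ)) * ∑ i, ((σ i : ℤ) : ℝ) * f (x i)|) / 2 ^ n

/-- The Rademacher complexity for `n` samples: the expectation of the empirical Rademacher
complexity over an i.i.d. sample of size `n` from `D`. -/
noncomputable def rademacherComplexity {X : Type*} [MeasurableSpace X] (F : Set (X → ℝ))
    (D : Measure X) (n : ℕ) : ℝ≥0∞ :=
  ∫⁻ x : Fin n → X, empiricalRademacher F x ∂(Measure.pi fun _ => D)

end RegLogistic

namespace RegLogistic

/-! ### Rademacher complexity of one-parameter Lipschitz classes. -/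

section Rademacher

/-! The class is a curve indexed by `λ`, so it is enough that almost surely `λ ↦ h_λ(P)` is
Lipschitz with constant `c * m`. A grid of about `c m (λmax - λmin) / ε²` values of `λ` is then a
uniform `ε²`-cover, and Massart's lemma on the grid gives the square root
(`rademacherComplexity_le_of_lipschitz`). The factor `c`, which carries `B` and `κ`, enters only
through a logarithm and is absorbed by taking `ε` small; hence `C` depends on `H` alone.

The validation loss is Lipschitz in the estimator, so the work lies in the regularization path. If
`u`, `v` minimize at `λ`, `λ'`, adding the quadratic growth inequalities at both cancels the losses
and bounds the curvature term in `u - v` by `|λ - λ'| |R(u) - R(v)|`.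

For `ℓ₂` the penalty supplies the curvature (`l2_path_lipschitz`). For `ℓ₁` it comes from the
Hessian on active coordinates, so the argument is local: by uniqueness and compactness the path is
continuous, so coordinates active at `λ` stay active nearby, and the difference is supported where
the Hessian at the nearby point is at least `κ`. That support has at most `m` elements, so `‖Δ‖₁² ≤
m ‖Δ‖₂²`, which produces the factor `m` (`l1_path_bound`). Local bounds with a common constant
integrate to a global one (`lipschitz_of_locally_lipschitz`). -/

theorem sum_exp_signs {n : ℕ} (a : Fin n → ℝ) :
    ∑ σ : Fin n → ℤˣ, Real.exp (∑ i, ((σ i : ℤ) : ℝ) * a i) = ∏ i, (2 * Real.cosh (a i)) := by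
  have h : ∀ i, 2 * Real.cosh (a i) = ∑ s : ℤˣ, Real.exp (((s : ℤ) : ℝ) * a i) := by
    intro i
    rw [UnitsInt.univ, Finset.sum_pair (by decide), Real.cosh_eq]
    simp
    ring
  simp_rw [h, Finset.prod_univ_sum, Fintype.piFinset_univ, Real.exp_sum]

theorem sum_exp_signs_le {n : ℕ} (a : Fin n → ℝ) {M : ℝ} (ha : ∀ i, |a i| ≤ M) :
    ∑ σ : Fin n → ℤˣ, Real.exp (∑ i, ((σ i : ℤ) : ℝ) * a i) ≤
      2 ^ n * Real.exp (n * M ^ 2 / 2) := by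
  rw [sum_exp_signs]
  calc ∏ i, (2 * Real.cosh (a i)) ≤ ∏ _i : Fin n, (2 * Real.exp (M ^ 2 / 2)) := by
        refine Finset.prod_le_prod (fun i _ => by positivity) fun i _ => ?_
        have h1 := Real.cosh_le_exp_half_sq (a i)
        have h2 : Real.exp (a i ^ 2 / 2) ≤ Real.exp (M ^ 2 / 2) := by
          have := sq_le_sq' (by linarith [neg_abs_le (a i), ha i]) ((le_abs_self _).trans (ha i))
          gcongr
        linarith
    _ = 2 ^ n * Real.exp (n * M ^ 2 / 2) := by
        simp only [Finset.prod_const, Finset.card_univ, Fintype.card_fin, mul_pow,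
          ← Real.exp_nat_mul]
        congr 2
        ring

/-- Massart's finite class lemma, for a selection `Z` dominated by the finite maximum. -/
theorem massart {ι : Type*} {n : ℕ} (hn : 0 < n) (t : Finset ι) (ht : t.Nonempty)
    (a : ι → Fin n → ℝ) {M : ℝ} (hM : 0 < M) (ha : ∀ j ∈ t, ∀ i, |a j i| ≤ M)
    (Z : (Fin n → ℤˣ) → ℝ)
    (hZ : ∀ σ, ∃ j ∈ t, Z σ ≤ |∑ i, ((σ i : ℤ) : ℝ) * a j i|) :
    ∑ σ, Z σ ≤ 2 ^ n * (n * (M * √(2 * Real.log (2 * t.card) / n))) := by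
  have hn' : (0 : ℝ) < n := by exact_mod_cast hn
  have hN : (1 : ℝ) ≤ t.card := by exact_mod_cast ht.card_pos
  have hlog : 0 < Real.log (2 * t.card) := Real.log_pos (by linarith)
  -- `s = q / M` is the optimal Chernoff parameter: it makes `log (2 * t.card)` equal to `n q² / 2`.
  -- The factor 2 in the logarithm pays for the absolute value, that is, for both signs of each sum.
  set q := √(2 * Real.log (2 * t.card) / n) with hq
  have hq0 : 0 < q := Real.sqrt_pos.2 (by positivity)
  have hqn : q ^ 2 * n = 2 * Real.log (2 * t.card) := by
    rw [hq, Real.sq_sqrt (by positivity)]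
    field_simp
  set s := q / M with hs
  have hs0 : 0 < s := by positivity
  have hsM : s * M = q := by rw [hs]; field_simp
  set A := 2 * (t.card : ℝ) * Real.exp (n * q ^ 2 / 2) with hA
  have hA0 : 0 < A := by positivity
  have hlogA : Real.log A = n * q ^ 2 := by
    rw [hA, Real.log_mul (by positivity) (by positivity), Real.log_exp]
    linarith
  have hsum : ∑ σ, Real.exp (s * Z σ) ≤ 2 ^ n * A := by
    calc ∑ σ, Real.exp (s * Z σ)
        ≤ ∑ σ : Fin n → ℤˣ, ∑ j ∈ t, (Real.exp (∑ i, ((σ i : ℤ) : ℝ) * (s * a j i)) +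
            Real.exp (∑ i, ((σ i : ℤ) : ℝ) * (-s * a j i))) := by
          refine Finset.sum_le_sum fun σ _ => ?_
          obtain ⟨j, hj, hjZ⟩ := hZ σ
          refine le_trans ?_ (Finset.single_le_sum (fun j _ => by positivity) hj)
          have e1 : ∑ i, ((σ i : ℤ) : ℝ) * (s * a j i) = s * ∑ i, ((σ i : ℤ) : ℝ) * a j i := by
            rw [Finset.mul_sum]; exact Finset.sum_congr rfl fun i _ => by ring
          have e2 : ∑ i, ((σ i : ℤ) : ℝ) * (-s * a j i) =
              s * -∑ i, ((σ i : ℤ) : ℝ) * a j i := by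
            rw [← Finset.sum_neg_distrib, Finset.mul_sum]
            exact Finset.sum_congr rfl fun i _ => by ring
          rw [e1, e2]
          rcases le_abs.1 hjZ with h | h
          · have : Real.exp (s * Z σ) ≤ _ := Real.exp_le_exp.2 (mul_le_mul_of_nonneg_left h hs0.le)
            linarith [Real.exp_pos (s * -∑ i, ((σ i : ℤ) : ℝ) * a j i)]
          · have : Real.exp (s * Z σ) ≤ _ := Real.exp_le_exp.2 (mul_le_mul_of_nonneg_left h hs0.le)
            linarith [Real.exp_pos (s * ∑ i, ((σ i : ℤ) : ℝ) * a j i)]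
      _ ≤ ∑ _j ∈ t, (2 ^ n * Real.exp (n * q ^ 2 / 2) + 2 ^ n * Real.exp (n * q ^ 2 / 2)) := by
          rw [Finset.sum_comm]
          refine Finset.sum_le_sum fun j hj => ?_
          rw [Finset.sum_add_distrib]
          have hb : ∀ i, s * |a j i| ≤ q := fun i => by
            rw [← hsM]; exact mul_le_mul_of_nonneg_left (ha j hj i) hs0.le
          refine add_le_add (sum_exp_signs_le _ fun i => ?_) (sum_exp_signs_le _ fun i => ?_)
          · rw [abs_mul, abs_of_pos hs0]; exact hb i
          · rw [abs_mul, abs_neg, abs_of_pos hs0]; exact hb i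
      _ = 2 ^ n * A := by
          rw [Finset.sum_const, nsmul_eq_mul, hA]; ring
  -- The tangent line to the exponential at `log A` replaces Jensen's inequality.
  have hlin : ∀ σ, s * Z σ ≤ Real.log A - 1 + Real.exp (s * Z σ) / A := fun σ => by
    have := Real.add_one_le_exp (s * Z σ - Real.log A)
    rw [Real.exp_sub, Real.exp_log hA0] at this
    linarith
  have hfin : s * ∑ σ, Z σ ≤ 2 ^ n * Real.log A := by
    calc s * ∑ σ, Z σ ≤ ∑ σ, (Real.log A - 1 + Real.exp (s * Z σ) / A) := by
          rw [Finset.mul_sum]; exact Finset.sum_le_sum fun σ _ => hlin σ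
      _ = 2 ^ n * (Real.log A - 1) + (∑ σ, Real.exp (s * Z σ)) / A := by
          rw [Finset.sum_add_distrib, Finset.sum_const, Finset.card_univ, Finset.sum_div,
            nsmul_eq_mul]
          simp
      _ ≤ 2 ^ n * (Real.log A - 1) + 2 ^ n := by
          gcongr
          exact (div_le_iff₀ hA0).2 hsum
      _ = 2 ^ n * Real.log A := by ring
  refine le_of_mul_le_mul_left (hfin.trans_eq ?_) hs0
  rw [hlogA, ← hsM]
  ring

/-- The empirical Rademacher complexity of a class with a finite uniform cover. -/
theorem empiricalRademacher_le_of_cover {X ι : Type*} {n : ℕ} (hn : 0 < n) (F : Set (X → ℝ))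
    (x : Fin n → X) (t : Finset ι) (ht : t.Nonempty) (g : ι → X → ℝ) {M δ : ℝ} (hM : 0 < M)
    (hg : ∀ j ∈ t, ∀ i, |g j (x i)| ≤ M)
    (hcov : ∀ f ∈ F, ∃ j ∈ t, ∀ i, |f (x i) - g j (x i)| ≤ δ) (hδ : 0 ≤ δ) :
    empiricalRademacher F x ≤
      ENNReal.ofReal (M * √(2 * Real.log (2 * t.card) / n) + δ) := by
  have hn' : (0 : ℝ) < n := by exact_mod_cast hn
  set Z : (Fin n → ℤˣ) → ℝ := fun σ => t.sup' ht fun j => |∑ i, ((σ i : ℤ) : ℝ) * g j (x i)|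
    with hZdef
  have hZ : ∀ σ, ∃ j ∈ t, Z σ ≤ |∑ i, ((σ i : ℤ) : ℝ) * g j (x i)| := fun σ => by
    obtain ⟨j, hj, h⟩ := t.exists_mem_eq_sup' ht fun j => |∑ i, ((σ i : ℤ) : ℝ) * g j (x i)|
    exact ⟨j, hj, h.le⟩
  have hZ0 : ∀ σ, 0 ≤ Z σ := fun σ => by
    obtain ⟨j, hj⟩ := ht
    exact (abs_nonneg _).trans (Finset.le_sup' (fun j => |∑ i, ((σ i : ℤ) : ℝ) * g j (x i)|) hj)
  have hmass := massart hn t ht (fun j i => g j (x i)) hM hg Z hZ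
  have hterm : ∀ σ : Fin n → ℤˣ,
      ⨆ f ∈ F, ENNReal.ofReal |(1 / (n : ℝ)) * ∑ i, ((σ i : ℤ) : ℝ) * f (x i)| ≤
        ENNReal.ofReal ((1 / (n : ℝ)) * Z σ + δ) := by
    intro σ
    refine iSup₂_le fun f hf => ENNReal.ofReal_le_ofReal ?_
    obtain ⟨j, hj, hfj⟩ := hcov f hf
    have h1 : |∑ i, ((σ i : ℤ) : ℝ) * f (x i)| ≤ Z σ + n * δ := by
      have e : ∑ i, ((σ i : ℤ) : ℝ) * f (x i) = ∑ i, ((σ i : ℤ) : ℝ) * g j (x i) +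
          ∑ i, ((σ i : ℤ) : ℝ) * (f (x i) - g j (x i)) := by
        rw [← Finset.sum_add_distrib]; exact Finset.sum_congr rfl fun i _ => by ring
      rw [e]
      refine (abs_add_le _ _).trans (add_le_add
        (Finset.le_sup' (fun j => |∑ i, ((σ i : ℤ) : ℝ) * g j (x i)|) hj) ?_)
      refine (Finset.abs_sum_le_sum_abs _ _).trans ?_
      calc ∑ i, |((σ i : ℤ) : ℝ) * (f (x i) - g j (x i))| ≤ ∑ _i : Fin n, δ := by
            refine Finset.sum_le_sum fun i _ => ?_
            rcases Int.units_eq_one_or (σ i) with h | h <;> simpa [h, abs_sub_comm] using hfj i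
        _ = n * δ := by simp
    rw [abs_mul, abs_of_pos (by positivity)]
    calc (1 / (n : ℝ)) * |∑ i, ((σ i : ℤ) : ℝ) * f (x i)|
        ≤ (1 / (n : ℝ)) * (Z σ + n * δ) := by gcongr
      _ = (1 / (n : ℝ)) * Z σ + δ := by field_simp
  unfold empiricalRademacher
  refine ENNReal.div_le_of_le_mul ((Finset.sum_le_sum fun σ _ => hterm σ).trans ?_)
  rw [← ENNReal.ofReal_sum_of_nonneg fun σ _ => by have := hZ0 σ; positivity]
  have h2 : (2 : ℝ≥0∞) ^ n = ENNReal.ofReal (2 ^ n) := by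
    rw [ENNReal.ofReal_pow (by norm_num)]; simp
  rw [h2, ← ENNReal.ofReal_mul (by positivity)]
  refine ENNReal.ofReal_le_ofReal ?_
  rw [Finset.sum_add_distrib, ← Finset.mul_sum]
  calc (1 / (n : ℝ)) * ∑ σ, Z σ + ∑ _σ : Fin n → ℤˣ, δ
      ≤ (1 / (n : ℝ)) * (2 ^ n * (n * (M * √(2 * Real.log (2 * t.card) / n)))) + 2 ^ n * δ := by
        refine add_le_add (by gcongr) ?_
        simp
    _ = (M * √(2 * Real.log (2 * t.card) / n) + δ) * 2 ^ n := by field_simp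

theorem exists_grid_point {a b : ℝ} {N : ℕ} (hN : 0 < N) {z : ℝ} (hz : z ∈ Set.Icc a b) :
    ∃ k ∈ Finset.range N, a + (b - a) / N * k ∈ Set.Icc a b ∧
      |z - (a + (b - a) / N * k)| ≤ (b - a) / N := by
  have hN' : (0 : ℝ) < N := by exact_mod_cast hN
  obtain ⟨h1, h2⟩ := hz
  rcases (h1.trans h2).eq_or_lt with hab | hab
  · refine ⟨0, Finset.mem_range.2 hN, ?_⟩
    have : z = a := le_antisymm (hab ▸ h2) h1
    subst hab
    simp [this]
  set w := (b - a) / N with hw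
  have hw0 : 0 < w := div_pos (sub_pos.2 hab) hN'
  have hwN : w * N = b - a := by rw [hw]; field_simp
  rcases h2.eq_or_lt with hzb | hzb
  -- Only left endpoints of the `N` cells are grid points, so `b` itself is served by the last of
  -- them.
  · refine ⟨N - 1, Finset.mem_range.2 (by omega), ?_⟩
    rw [Nat.cast_sub hN, Nat.cast_one]
    have hge : (1 : ℝ) ≤ N := by exact_mod_cast hN
    have e : a + w * (N - 1) = b - w := by linarith
    have : 0 ≤ w * (N - 1) := mul_nonneg hw0.le (by linarith)
    rw [e, hzb]
    refine ⟨⟨by linarith, by linarith⟩, ?_⟩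
    rw [abs_le]; constructor <;> linarith
  · set k := ⌊(z - a) / w⌋₊ with hk
    have hk1 : (k : ℝ) ≤ (z - a) / w := Nat.floor_le (div_nonneg (by linarith) hw0.le)
    have hk2 : (z - a) / w < k + 1 := Nat.lt_floor_add_one _
    rw [le_div_iff₀ hw0] at hk1
    rw [div_lt_iff₀ hw0] at hk2
    have hkN : k < N := by
      have : (k : ℝ) * w < N * w := by linarith
      exact_mod_cast lt_of_mul_lt_mul_right this hw0.le
    refine ⟨k, Finset.mem_range.2 hkN, ⟨?_, by linarith⟩, ?_⟩
    · have : 0 ≤ w * k := by positivity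
      linarith
    · rw [abs_le]; constructor <;> linarith

theorem empiricalRademacher_le_of_lipschitz {X : Type*} {n : ℕ} (hn : 0 < n) {a b : ℝ}
    (h : ℝ → X → ℝ) (x : Fin n → X) {M L : ℝ} (hab : a ≤ b) (hM : 0 < M) (hL : 0 ≤ L)
    (hbd : ∀ i, ∀ z ∈ Set.Icc a b, |h z (x i)| ≤ M)
    (hlip : ∀ i, ∀ z ∈ Set.Icc a b, ∀ w ∈ Set.Icc a b, |h z (x i) - h w (x i)| ≤ L * |z - w|)
    {N : ℕ} (hN : 0 < N) :
    empiricalRademacher {f | ∃ z ∈ Set.Icc a b, f = h z} x ≤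
      ENNReal.ofReal (M * √(2 * Real.log (2 * N) / n) + L * ((b - a) / N)) := by
  have hw0 : 0 ≤ (b - a) / N := div_nonneg (sub_nonneg.2 hab) (Nat.cast_nonneg N)
  have hmem : ∀ k ∈ Finset.range N, a + (b - a) / N * k ∈ Set.Icc a b := by
    intro k hk
    have hk' : (k : ℝ) ≤ N := by exact_mod_cast (Finset.mem_range.1 hk).le
    have hN' : (0 : ℝ) < N := by exact_mod_cast hN
    have h1 : (b - a) / N * k ≤ (b - a) / N * N := mul_le_mul_of_nonneg_left hk' hw0
    have h2 : (b - a) / N * N = b - a := by field_simp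
    have : 0 ≤ (b - a) / N * k := by positivity
    constructor <;> linarith
  have := empiricalRademacher_le_of_cover hn {f | ∃ z ∈ Set.Icc a b, f = h z} x (Finset.range N)
    ⟨0, Finset.mem_range.2 hN⟩ (fun k => h (a + (b - a) / N * k)) (M := M)
    (δ := L * ((b - a) / N)) hM (fun k hk i => hbd i _ (hmem k hk)) ?_ (by positivity)
  · simpa using this
  · rintro f ⟨z, hz, rfl⟩
    obtain ⟨k, hk, hkm, hkd⟩ := exists_grid_point hN hz
    exact ⟨k, hk, fun i => (hlip i z hz _ hkm).trans (by gcongr)⟩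

/-- Continuity in the parameter lets the supremum be taken over a countable dense set of parameters,
for almost every sample. -/
theorem aemeasurable_empiricalRademacher {X : Type*} [MeasurableSpace X] (D : Measure X)
    [IsProbabilityMeasure D] {a b : ℝ} (h : ℝ → X → ℝ)
    (hmeas : ∀ z ∈ Set.Icc a b, AEMeasurable (h z) D)
    (hcont : ∀ᵐ P ∂D, ContinuousOn (fun z => h z P) (Set.Icc a b)) (n : ℕ) :
    AEMeasurable (fun x : Fin n → X => empiricalRademacher {f | ∃ z ∈ Set.Icc a b, f = h z} x)
      (Measure.pi fun _ => D) := by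
  obtain ⟨s, hs, hsd⟩ := TopologicalSpace.exists_countable_dense (Set.Icc a b)
  have hcont' : ∀ᵐ x ∂(Measure.pi fun _ : Fin n => D),
      ∀ i, ContinuousOn (fun z => h z (x i)) (Set.Icc a b) :=
    ae_all_iff.2 fun i => (Measure.quasiMeasurePreserving_eval (fun _ => D) i).ae hcont
  have hm : ∀ (z : Set.Icc a b) (i : Fin n),
      AEMeasurable (fun x : Fin n → X => h z (x i)) (Measure.pi fun _ => D) := fun z i =>
    (hmeas z z.2).comp_quasiMeasurePreserving (Measure.quasiMeasurePreserving_eval (fun _ => D) i)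
  have key : AEMeasurable (fun x : Fin n → X => (∑ σ : Fin n → ℤˣ,
      ⨆ z ∈ s, ENNReal.ofReal |(1 / (n : ℝ)) * ∑ i, ((σ i : ℤ) : ℝ) * h z (x i)|) / 2 ^ n)
      (Measure.pi fun _ => D) := by
    refine AEMeasurable.div_const (Finset.aemeasurable_fun_sum _ fun σ _ =>
      AEMeasurable.biSup s hs fun z _ => ?_) _
    have h1 : AEMeasurable (fun x : Fin n → X =>
        (1 / (n : ℝ)) * ∑ i, ((σ i : ℤ) : ℝ) * h z (x i)) (Measure.pi fun _ => D) :=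
      (Finset.aemeasurable_fun_sum _ fun i _ => (hm z i).const_mul _).const_mul _
    exact (continuous_abs.measurable.comp_aemeasurable h1).ennreal_ofReal
  refine key.congr ?_
  filter_upwards [hcont'] with x hx
  unfold empiricalRademacher
  congr 1
  refine Finset.sum_congr rfl fun σ _ => ?_
  set φ : Set.Icc a b → ℝ≥0∞ := fun z =>
    ENNReal.ofReal |(1 / (n : ℝ)) * ∑ i, ((σ i : ℤ) : ℝ) * h z (x i)| with hφ
  have hφc : Continuous φ := by
    refine ENNReal.continuous_ofReal.comp (continuous_abs.comp (continuous_const.mul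
      (continuous_finsetSum _ fun i _ => continuous_const.mul ?_)))
    exact continuousOn_iff_continuous_domRestrict.1 (hx i)
  apply le_antisymm
  · exact iSup₂_le fun z _ => le_iSup₂_of_le (h z) ⟨z, z.2, rfl⟩ le_rfl
  · refine iSup₂_le ?_
    rintro f ⟨z, hz, rfl⟩
    have hcl : IsClosed {z | φ z ≤ ⨆ z ∈ s, φ z} := isClosed_le hφc continuous_const
    have hsub : s ⊆ {z | φ z ≤ ⨆ z ∈ s, φ z} := fun z hz => le_iSup₂ (f := fun z _ => φ z) z hz
    exact hcl.closure_subset_iff.2 hsub (hsd ⟨z, hz⟩)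

/-- Rademacher complexity of a bounded one-parameter class that is Lipschitz in the parameter. -/
theorem rademacherComplexity_le_of_lipschitz {X : Type*} [MeasurableSpace X] (D : Measure X)
    [IsProbabilityMeasure D] {a b : ℝ} (hab : a ≤ b) (h : ℝ → X → ℝ) {M c : ℝ} {m : ℕ}
    (hm : 0 < m) (hM : 0 < M) (hc : 0 ≤ c)
    (hbd : ∀ᵐ P ∂D, ∀ z ∈ Set.Icc a b, |h z P| ≤ M)
    (hlip : ∀ᵐ P ∂D, ∀ z ∈ Set.Icc a b, ∀ w ∈ Set.Icc a b,
      |h z P - h w P| ≤ c * m * |z - w|)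
    {n : ℕ} (hn : 0 < n) {ε : ℝ} (hε : 0 < ε) (hε' : ε < 1 / (4 + 2 * c * (b - a))) :
    rademacherComplexity {f | ∃ z ∈ Set.Icc a b, f = h z} D n ≤
      ENNReal.ofReal ((3 * M + 1) * (√(((m : ℝ) ^ 2 + Real.log (1 / ε)) / (n : ℝ)) + ε ^ 2)) := by
  have hn' : (0 : ℝ) < n := by exact_mod_cast hn
  have hm' : (1 : ℝ) ≤ m := by exact_mod_cast hm
  have hW : 0 ≤ b - a := sub_nonneg.2 hab
  have hcW : 0 ≤ c * (b - a) := mul_nonneg hc hW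
  set K := 4 + 2 * c * (b - a) with hK
  have hK0 : 4 ≤ K := by rw [hK]; linarith
  have hεK : K ≤ 1 / ε := by
    rw [lt_div_iff₀ (by linarith)] at hε'
    rw [le_div_iff₀ hε]
    linarith
  have hε1 : ε ≤ 1 := by
    rw [le_div_iff₀ hε] at hεK
    nlinarith
  have hε2 : ε ^ 2 ≤ 1 := pow_le_one₀ hε.le hε1
  -- Enough cells for discretization error `ε²`; the `+ 1` keeps `N` positive when `c = 0` or `a =
  -- b`.
  set N : ℕ := ⌈c * m * (b - a) / ε ^ 2⌉₊ + 1 with hNdef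
  have hN : 0 < N := Nat.succ_pos _
  have hN1 : c * m * (b - a) / ε ^ 2 ≤ N := by
    rw [hNdef]; push_cast; linarith [Nat.le_ceil (c * m * (b - a) / ε ^ 2)]
  have hN2 : (N : ℝ) ≤ c * m * (b - a) / ε ^ 2 + 2 := by
    rw [hNdef]; push_cast
    have : 0 ≤ c * m * (b - a) / ε ^ 2 := by positivity
    linarith [Nat.ceil_lt_add_one this]
  have hN0 : (0 : ℝ) < N := by exact_mod_cast hN
  have hδ : c * m * ((b - a) / N) ≤ ε ^ 2 := by
    rw [← mul_div_assoc, div_le_iff₀ hN0]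
    rw [div_le_iff₀ (by positivity)] at hN1
    linarith
  have hlogN : Real.log (2 * N) ≤ 3 * ((m : ℝ) ^ 2 + Real.log (1 / ε)) := by
    -- Two powers of `1 / ε` come from the mesh; the third absorbs `K`, hence `c` and `b - a`, by
    -- the threshold on `ε`.
    have h1 : 2 * (N : ℝ) ≤ m * (1 / ε) ^ 3 := by
      calc 2 * (N : ℝ) ≤ 2 * (c * m * (b - a) / ε ^ 2 + 2) := by linarith
        _ = (2 * c * (b - a) * m + 4 * ε ^ 2) / ε ^ 2 := by field_simp; ring
        _ ≤ (K * m) / ε ^ 2 := by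
            gcongr
            rw [hK]
            nlinarith
        _ ≤ (1 / ε * m) / ε ^ 2 := by gcongr
        _ = m * (1 / ε) ^ 3 := by field_simp
    have h2 := Real.log_le_log (by positivity) h1
    rw [Real.log_mul (x := (m : ℝ)) (by positivity) (by positivity), Real.log_pow] at h2
    -- The term `m²` of the bound only has to dominate `log m`.
    have h3 := Real.log_le_sub_one_of_pos (show (0 : ℝ) < m by linarith)
    push_cast at h2
    nlinarith
  have hB : 0 ≤ ((m : ℝ) ^ 2 + Real.log (1 / ε)) / n := by
    have : 0 ≤ Real.log (1 / ε) := Real.log_nonneg (by linarith)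
    positivity
  have hreal : M * √(2 * Real.log (2 * N) / n) + c * m * ((b - a) / N) ≤
      (3 * M + 1) * (√(((m : ℝ) ^ 2 + Real.log (1 / ε)) / (n : ℝ)) + ε ^ 2) := by
    have h1 : √(2 * Real.log (2 * N) / n) ≤
        3 * √(((m : ℝ) ^ 2 + Real.log (1 / ε)) / (n : ℝ)) := by
      rw [Real.sqrt_le_left (by positivity), mul_pow, Real.sq_sqrt hB, ← mul_div_assoc]
      have : 0 ≤ Real.log (1 / ε) := Real.log_nonneg (by linarith)
      refine div_le_div_of_nonneg_right ?_ hn'.le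
      linarith [sq_nonneg (m : ℝ)]
    have h2 : 0 ≤ √(((m : ℝ) ^ 2 + Real.log (1 / ε)) / (n : ℝ)) := Real.sqrt_nonneg _
    have h3 := mul_le_mul_of_nonneg_left h1 hM.le
    have h4 : 0 ≤ M * ε ^ 2 := by positivity
    linarith
  have hae : ∀ᵐ x ∂(Measure.pi fun _ : Fin n => D),
      empiricalRademacher {f | ∃ z ∈ Set.Icc a b, f = h z} x ≤
        ENNReal.ofReal (M * √(2 * Real.log (2 * N) / n) + c * m * ((b - a) / N)) := by
    have h1 : ∀ᵐ x ∂(Measure.pi fun _ : Fin n => D), ∀ i, ∀ z ∈ Set.Icc a b, |h z (x i)| ≤ M :=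
      ae_all_iff.2 fun i => (Measure.quasiMeasurePreserving_eval (fun _ => D) i).ae hbd
    have h2 : ∀ᵐ x ∂(Measure.pi fun _ : Fin n => D), ∀ i, ∀ z ∈ Set.Icc a b,
        ∀ w ∈ Set.Icc a b, |h z (x i) - h w (x i)| ≤ c * m * |z - w| :=
      ae_all_iff.2 fun i => (Measure.quasiMeasurePreserving_eval (fun _ => D) i).ae hlip
    filter_upwards [h1, h2] with x hx1 hx2
    exact empiricalRademacher_le_of_lipschitz hn h x hab hM (by positivity) hx1 hx2 hN
  unfold rademacherComplexity
  refine (lintegral_mono_ae hae).trans ?_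
  simpa using ENNReal.ofReal_le_ofReal hreal

end Rademacher

/-! ### Curvature of the scalar logistic loss. -/

section Scalar

/-- The derivative of the sigmoid function. -/
noncomputable def sigmoidSlope (z : ℝ) : ℝ := Real.sigmoid z * (1 - Real.sigmoid z)

theorem sigmoidSlope_pos (z : ℝ) : 0 < sigmoidSlope z :=
  mul_pos (Real.sigmoid_pos z) (sub_pos.2 (Real.sigmoid_lt_one z))

theorem continuous_sigmoidSlope : Continuous sigmoidSlope := by
  unfold sigmoidSlope
  exact continuous_sigmoid.mul (continuous_const.sub continuous_sigmoid)

/-- The comparison is with the slope at the moving endpoint `z'`, since for the `ℓ₁` path the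
Hessian is used at the nearby minimizer. -/
theorem eventually_sigmoidSlope_ge (z₀ : ℝ) :
    ∀ᶠ z' in nhds z₀, ∀ z ∈ Set.uIcc z₀ z', 1 / 2 * sigmoidSlope z' ≤ sigmoidSlope z := by
  have hw := sigmoidSlope_pos z₀
  have h1 : ∀ᶠ z in nhds z₀, sigmoidSlope z ∈
      Set.Ioo (3 / 4 * sigmoidSlope z₀) (5 / 4 * sigmoidSlope z₀) :=
    continuous_sigmoidSlope.continuousAt.eventually
      (Ioo_mem_nhds (by linarith) (by linarith))
  obtain ⟨δ, hδ, h⟩ := Metric.eventually_nhds_iff_ball.1 h1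
  refine Metric.eventually_nhds_iff_ball.2 ⟨δ, hδ, fun z' hz' z hz => ?_⟩
  have hzb : z ∈ Metric.ball z₀ δ := by
    rw [← segment_eq_uIcc] at hz
    exact (convex_ball z₀ δ).segment_subset (Metric.mem_ball_self hδ) hz' hz
  linarith [(h z hzb).1, (h z' hz').2]

theorem hasDerivAt_log_one_add_exp_neg (z : ℝ) :
    HasDerivAt (fun z => Real.log (1 + Real.exp (-z))) (Real.sigmoid z - 1) z := by
  have h := (((hasDerivAt_neg z).exp.const_add 1).log (by positivity))
  convert h using 1
  rw [Real.sigmoid_def]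
  field_simp
  ring

/-- Subtracting `μ z² / 2` leaves a function with nonnegative second derivative on the segment. -/
theorem log_one_add_exp_neg_segment {a b μ : ℝ} (hμ : ∀ z ∈ Set.uIcc a b, μ ≤ sigmoidSlope z)
    {t : ℝ} (ht0 : 0 ≤ t) (ht1 : t ≤ 1) :
    Real.log (1 + Real.exp (-((1 - t) * a + t * b))) ≤
      (1 - t) * Real.log (1 + Real.exp (-a)) + t * Real.log (1 + Real.exp (-b)) -
        t * (1 - t) / 2 * (μ * (b - a) ^ 2) := by
  have hconv : ConvexOn ℝ (Set.uIcc a b)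
      (fun z => Real.log (1 + Real.exp (-z)) - μ / 2 * z ^ 2) := by
    have h1 : ∀ z, HasDerivAt (fun z => Real.log (1 + Real.exp (-z)) - μ / 2 * z ^ 2)
        (Real.sigmoid z - 1 - μ * z) z := fun z => by
      refine ((hasDerivAt_log_one_add_exp_neg z).fun_sub
        ((hasDerivAt_pow 2 z).const_mul (μ / 2))).congr_deriv ?_
      push_cast
      ring
    have h2 : ∀ z, HasDerivAt (fun z => Real.sigmoid z - 1 - μ * z) (sigmoidSlope z - μ) z :=
      fun z => by
      refine (((Real.hasDerivAt_sigmoid z).sub_const 1).fun_sub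
        ((hasDerivAt_id' z).const_mul μ)).congr_deriv ?_
      rw [sigmoidSlope, mul_one]
    refine convexOn_of_hasDerivWithinAt2_nonneg (convex_uIcc a b)
      (fun z _ => (h1 z).continuousAt.continuousWithinAt)
      (fun z _ => (h1 z).hasDerivWithinAt) (fun z _ => (h2 z).hasDerivWithinAt) fun z hz => ?_
    exact sub_nonneg.2 (hμ z (interior_subset hz))
  have h := hconv.2 Set.left_mem_uIcc Set.right_mem_uIcc (sub_nonneg.2 ht1) ht0 (by ring)
  simp only [smul_eq_mul] at h
  linarith

theorem log_one_add_exp_segment (s : ℤˣ) {a b μ : ℝ}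
    (hμ : ∀ z ∈ Set.uIcc a b, μ ≤ sigmoidSlope z) {t : ℝ} (ht0 : 0 ≤ t) (ht1 : t ≤ 1) :
    Real.log (1 + Real.exp (-(((s : ℤ) : ℝ) * ((1 - t) * a + t * b)))) ≤
      (1 - t) * Real.log (1 + Real.exp (-(((s : ℤ) : ℝ) * a))) +
        t * Real.log (1 + Real.exp (-(((s : ℤ) : ℝ) * b))) -
        t * (1 - t) / 2 * (μ * (b - a) ^ 2) := by
  have h := log_one_add_exp_neg_segment hμ ht0 ht1
  rcases Int.units_eq_one_or s with rfl | rfl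
  · simpa using h
  -- Flipping the label changes the loss by a linear term, which does not affect convexity defects.
  · have e : ∀ z : ℝ, Real.log (1 + Real.exp z) = Real.log (1 + Real.exp (-z)) + z := fun z => by
      rw [show 1 + Real.exp z = (1 + Real.exp (-z)) * Real.exp z by
        rw [add_mul, ← Real.exp_add]; simp; ring, Real.log_mul (by positivity) (by positivity),
        Real.log_exp]
    have e' : ∀ z : ℝ, -((((-1 : ℤˣ) : ℤ) : ℝ) * z) = z := fun z => by simp
    rw [e', e', e', e, e a, e b]
    linarith

theorem abs_log_one_add_exp_sub_le (s : ℤˣ) (a b : ℝ) :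
    |Real.log (1 + Real.exp (-(((s : ℤ) : ℝ) * a))) -
      Real.log (1 + Real.exp (-(((s : ℤ) : ℝ) * b)))| ≤ |a - b| := by
  have h : ∀ x y : ℝ, |Real.log (1 + Real.exp (-x)) - Real.log (1 + Real.exp (-y))| ≤ |x - y| := by
    intro x y
    have := convex_univ.norm_image_sub_le_of_norm_hasDerivWithin_le (C := 1)
      (fun z _ => (hasDerivAt_log_one_add_exp_neg z).hasDerivWithinAt)
      (fun z _ => by
        rw [Real.norm_eq_abs, abs_le]
        constructor <;> linarith [Real.sigmoid_pos z, Real.sigmoid_lt_one z])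
      (Set.mem_univ y) (Set.mem_univ x)
    simpa using this
  refine (h _ _).trans ?_
  rw [← mul_sub, abs_mul]
  rcases Int.units_eq_one_or s with rfl | rfl <;> simp

end Scalar

/-! ### The logistic loss of a data set and its Hessian. -/

section Loss

variable {k p : ℕ}

theorem logisticLoss_nonneg (β : Fin p → ℝ) (S : DataSet k p) : 0 ≤ logisticLoss β S := by
  unfold logisticLoss
  refine mul_nonneg (by positivity) (Finset.sum_nonneg fun i _ => Real.log_nonneg ?_)
  linarith [Real.exp_pos (-(((S.2 i : ℤ) : ℝ) * (S.1 i ⬝ᵥ β)))]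

theorem logisticLoss_zero_le (S : DataSet k p) : logisticLoss 0 S ≤ 1 := by
  have h2 : Real.log (1 + 1) ≤ 1 := by
    have := Real.log_le_sub_one_of_pos (show (0 : ℝ) < 1 + 1 by norm_num)
    linarith
  rcases Nat.eq_zero_or_pos k with rfl | hk
  · simp [logisticLoss]
  · have hk' : (0 : ℝ) < k := by exact_mod_cast hk
    have : logisticLoss 0 S = Real.log (1 + 1) := by simp [logisticLoss]; field_simp
    rwa [this]

theorem continuous_logisticLoss :
    Continuous fun q : (Fin p → ℝ) × DataSet k p => logisticLoss q.1 q.2 := by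
  unfold logisticLoss
  refine continuous_const.mul (continuous_finsetSum _ fun i _ => Continuous.log ?_ fun q => ?_)
  · have h1 : Continuous fun q : (Fin p → ℝ) × DataSet k p => ((q.2.2 i : ℤ) : ℝ) :=
      continuous_of_discreteTopology.comp
        (Units.continuous_val.comp ((continuous_apply i).comp continuous_snd.snd))
    have h2 : Continuous fun q : (Fin p → ℝ) × DataSet k p => q.2.1 i ⬝ᵥ q.1 :=
      Continuous.dotProduct ((continuous_apply i).comp continuous_snd.fst) continuous_fst
    exact continuous_const.add (Real.continuous_exp.comp (h1.mul h2).neg)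
  · positivity

theorem logisticLoss_segment (S : DataSet k p) (u v : Fin p → ℝ) (μ : Fin k → ℝ)
    (hμ : ∀ i, ∀ z ∈ Set.uIcc (S.1 i ⬝ᵥ u) (S.1 i ⬝ᵥ v), μ i ≤ sigmoidSlope z)
    {t : ℝ} (ht0 : 0 ≤ t) (ht1 : t ≤ 1) :
    logisticLoss ((1 - t) • u + t • v) S ≤ (1 - t) * logisticLoss u S + t * logisticLoss v S -
      t * (1 - t) / 2 * ((1 / (k : ℝ)) * ∑ i, μ i * (S.1 i ⬝ᵥ (v - u)) ^ 2) := by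
  have h : ∀ i, _ := fun i => log_one_add_exp_segment (S.2 i) (hμ i) ht0 ht1
  have hs := mul_le_mul_of_nonneg_left (Finset.sum_le_sum fun i (_ : i ∈ Finset.univ) => h i)
    (show 0 ≤ 1 / (k : ℝ) by positivity)
  rw [Finset.sum_sub_distrib, Finset.sum_add_distrib, ← Finset.mul_sum, ← Finset.mul_sum,
    ← Finset.mul_sum] at hs
  unfold logisticLoss
  simp only [dotProduct_add, dotProduct_smul, dotProduct_sub, smul_eq_mul]
  linarith

theorem abs_logisticLoss_sub_le (hk : 0 < k) (S : DataSet k p) (u v : Fin p → ℝ) {r : ℝ}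
    (hr : ∀ i, |S.1 i ⬝ᵥ (u - v)| ≤ r) : |logisticLoss u S - logisticLoss v S| ≤ r := by
  have hk' : (0 : ℝ) < k := by exact_mod_cast hk
  unfold logisticLoss
  rw [← mul_sub, ← Finset.sum_sub_distrib, abs_mul, abs_of_pos (by positivity)]
  calc (1 / (k : ℝ)) * |∑ i, _| ≤ (1 / (k : ℝ)) * ∑ _i : Fin k, r := by
        gcongr
        refine (Finset.abs_sum_le_sum_abs _ _).trans (Finset.sum_le_sum fun i _ => ?_)
        refine (abs_log_one_add_exp_sub_le _ _ _).trans ?_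
        rw [← dotProduct_sub]
        exact hr i
    _ = r := by simp; field_simp

theorem dotProduct_logisticHessian_mulVec (β v : Fin p → ℝ) (S : DataSet k p) :
    v ⬝ᵥ (logisticHessian β S).mulVec v =
      (1 / (k : ℝ)) * ∑ i, sigmoidSlope (S.1 i ⬝ᵥ β) * (S.1 i ⬝ᵥ v) ^ 2 := by
  have h : ∀ i, sigmoidSlope (S.1 i ⬝ᵥ β) * (S.1 i ⬝ᵥ v) ^ 2 =
      ∑ a, ∑ b, sigmoidSlope (S.1 i ⬝ᵥ β) * (S.1 i a * v a * (S.1 i b * v b)) := fun i => by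
    have e : (S.1 i ⬝ᵥ v) ^ 2 = ∑ a, ∑ b, S.1 i a * v a * (S.1 i b * v b) := by
      rw [sq, dotProduct, Finset.sum_mul_sum]
    rw [e, Finset.mul_sum]
    exact Finset.sum_congr rfl fun a _ => by rw [Finset.mul_sum]
  simp_rw [h]
  rw [Finset.sum_comm, Finset.mul_sum]
  unfold dotProduct Matrix.mulVec
  refine Finset.sum_congr rfl fun a _ => ?_
  rw [Finset.sum_comm, Finset.mul_sum, dotProduct, Finset.mul_sum]
  refine Finset.sum_congr rfl fun b _ => ?_
  simp only [logisticHessian, Matrix.of_apply, sigmoidSlope, dotProduct]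
  rw [Finset.mul_sum, Finset.mul_sum, Finset.sum_mul, Finset.mul_sum]
  exact Finset.sum_congr rfl fun i _ => by ring

/-- A vector supported on `A` and orthogonal to all `k` feature vectors has zero Hessian form, so it
vanishes; the data matrix thus embeds `ℝ^A` into `ℝ^k`. -/
theorem card_le_of_logisticHessian_pos (S : DataSet k p) (β : Fin p → ℝ) (A : Finset (Fin p))
    {κ : ℝ} (hκ : 0 < κ) (h : ∀ v : Fin p → ℝ, (∀ j ∉ A, v j = 0) →
      κ * (v ⬝ᵥ v) ≤ v ⬝ᵥ (logisticHessian β S).mulVec v) : A.card ≤ k := by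
  set ext := Function.ExtendByZero.linearMap ℝ ((↑) : A → Fin p) with hext
  set T := (Matrix.mulVecLin (Matrix.of S.1)) ∘ₗ ext with hT
  have hinj : Function.Injective T := by
    rw [← LinearMap.ker_eq_bot, LinearMap.ker_eq_bot']
    intro v hv
    have h0 : ∀ i, S.1 i ⬝ᵥ ext v = 0 := fun i => congrFun hv i
    have h1 := h (ext v) fun j hj => by
      simp only [hext, Function.ExtendByZero.linearMap_apply]
      rw [Function.extend_apply']
      · rfl
      · rintro ⟨a, rfl⟩; exact hj a.2
    rw [dotProduct_logisticHessian_mulVec] at h1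
    simp only [h0] at h1
    have h2 : ext v ⬝ᵥ ext v = 0 := by
      refine le_antisymm ?_ (Finset.sum_nonneg fun j _ => mul_self_nonneg _)
      have h3 : κ * (ext v ⬝ᵥ ext v) ≤ 0 := by simpa using h1
      exact nonpos_of_mul_nonpos_right h3 hκ
    have h3 : ext v = 0 := dotProduct_self_eq_zero.1 h2
    funext a
    have := congrFun h3 a
    simp only [hext, Function.ExtendByZero.linearMap_apply] at this
    rwa [Subtype.val_injective.extend_apply] at this
  simpa using LinearMap.finrank_le_finrank_of_injective hinj

end Loss

/-! ### Existence, continuity and measurability of minimizers. -/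

section Minimizer

/-- Away from a neighbourhood of `β t₀` the objective at `t₀` strictly exceeds its minimum;
compactness preserves this against the fixed competitor `β t₀` for nearby `t`. -/
theorem continuousOn_argmin {T E : Type*} [TopologicalSpace T] [TopologicalSpace E]
    {F : T → E → ℝ} (hF : Continuous fun q : T × E => F q.1 q.2) {K : Set E} (hK : IsCompact K)
    {A : Set T} {β : T → E} (hβK : ∀ t ∈ A, β t ∈ K) (hmin : ∀ t ∈ A, ∀ γ, F t (β t) ≤ F t γ)
    (huniq : ∀ t ∈ A, ∀ γ, (∀ γ', F t γ ≤ F t γ') → γ = β t) : ContinuousOn β A := by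
  intro t₀ ht₀
  refine tendsto_nhds.2 fun U hU hmem => ?_
  have hcomp : IsCompact (K \ U) := hK.diff hU
  have hev : ∀ᶠ t in nhds t₀, ∀ γ ∈ K \ U, F t (β t₀) < F t γ := by
    refine hcomp.eventually_forall_of_forall_eventually fun γ hγ => ?_
    have hlt : F t₀ (β t₀) < F t₀ γ := by
      refine lt_of_le_of_ne (hmin t₀ ht₀ γ) fun he => hγ.2 ?_
      rw [huniq t₀ ht₀ γ fun γ' => he ▸ hmin t₀ ht₀ γ']
      exact hmem
    have hc : Continuous fun q : T × E => F q.1 (β t₀) :=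
      hF.comp (continuous_fst.prodMk continuous_const)
    exact (isOpen_lt hc hF).mem_nhds hlt
  filter_upwards [mem_nhdsWithin_of_mem_nhds hev, self_mem_nhdsWithin] with t ht htA
  by_contra hU'
  exact absurd (hmin t htA (β t₀)) (not_le.2 (ht (β t) ⟨hβK t htA, hU'⟩))

theorem add_le_of_isMin_of_segment {E : Type*} [AddCommGroup E] [Module ℝ E] {f : E → ℝ}
    {u v : E} {c : ℝ} (hu : ∀ w, f u ≤ f w)
    (h : ∀ t ∈ Set.Ioo (0 : ℝ) 1,
      f ((1 - t) • u + t • v) ≤ (1 - t) * f u + t * f v - t * (1 - t) * c) :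
    f u + c ≤ f v := by
  by_contra! hlt
  have hD := hu v
  have hc : 0 < c := by linarith
  have hkey : ∀ t ∈ Set.Ioo (0 : ℝ) 1, (1 - t) * c ≤ f v - f u := fun t ht => by
    refine le_of_mul_le_mul_left ?_ ht.1
    linarith [hu ((1 - t) • u + t • v), h t ht]
  -- An explicit small `t` stands in for the limit `t → 0` in `(1 - t) c ≤ f v - f u`.
  have h2 := hkey ((c - (f v - f u)) / (2 * c)) ⟨div_pos (by linarith) (by linarith), by
    rw [div_lt_one (by linarith)]; linarith⟩
  have e : (1 - (c - (f v - f u)) / (2 * c)) * c = (c + (f v - f u)) / 2 := by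
    field_simp
    ring
  rw [e] at h2
  linarith

variable {k p : ℕ} {R : (Fin p → ℝ) → ℝ}

theorem IsRegMinimizer.penalty_le {S : DataSet k p} {lam : ℝ} {β : Fin p → ℝ} (hR0 : R 0 = 0)
    (hlam : 0 < lam) (h : IsRegMinimizer R S lam β) : R β ≤ 1 / lam := by
  have h0 := h 0
  rw [hR0] at h0
  rw [le_div_iff₀ hlam]
  linarith [logisticLoss_nonneg β S, logisticLoss_zero_le S]

theorem continuous_objective (hRc : Continuous R) :
    Continuous fun q : (ℝ × DataSet k p) × (Fin p → ℝ) =>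
      logisticLoss q.2 q.1.2 + q.1.1 * R q.2 :=
  (continuous_logisticLoss.comp (continuous_snd.prodMk continuous_fst.snd)).add
    (continuous_fst.fst.mul (hRc.comp continuous_snd))

/-- Outside a large box the penalty term alone exceeds 1, which bounds the objective at `0`. The `+
1` in `hRb` lets one coercivity hypothesis cover both penalties, as `|x| ≤ x² + 1`. -/
theorem exists_isRegMinimizer (hRc : Continuous R) (hR0 : R 0 = 0)
    (hRb : ∀ β j, |β j| ≤ R β + 1) (S : DataSet k p) {lam : ℝ} (hlam : 0 < lam) :
    ∃ β, IsRegMinimizer R S lam β := by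
  set r := 1 / lam + 1 with hr
  have hr0 : 0 < r := by positivity
  have hc : Continuous fun β => logisticLoss β S + lam * R β :=
    
    (continuous_logisticLoss.comp (continuous_id.prodMk continuous_const)).add
      (continuous_const.mul hRc)
  have h0 : (0 : Fin p → ℝ) ∈ Set.Icc (fun _ => -r : Fin p → ℝ) (fun _ => r) :=
    ⟨fun _ => by simpa using hr0.le, fun _ => hr0.le⟩
  obtain ⟨β, hβ, hmin⟩ := (isCompact_Icc (a := (fun _ => -r : Fin p → ℝ))
    (b := fun _ => r)).exists_isMinOn ⟨0, h0⟩ hc.continuousOn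
  refine ⟨β, fun γ => ?_⟩
  by_cases hγ : γ ∈ Set.Icc (fun _ => -r : Fin p → ℝ) (fun _ => r)
  · exact hmin hγ
  · have h1 : ∃ j, r < |γ j| := by
      by_contra! hcon
      exact hγ ⟨fun j => (abs_le.1 (hcon j)).1, fun j => (abs_le.1 (hcon j)).2⟩
    obtain ⟨j, hj⟩ := h1
    have h2 : 1 / lam < R γ := by linarith [hRb γ j]
    rw [div_lt_iff₀ hlam] at h2
    have h3 : logisticLoss β S + lam * R β ≤ logisticLoss 0 S + lam * R 0 := hmin h0
    rw [hR0] at h3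
    linarith [logisticLoss_zero_le S, logisticLoss_nonneg γ S]

theorem isRegMinimizer_estimator (hRc : Continuous R) (hR0 : R 0 = 0)
    (hRb : ∀ β j, |β j| ≤ R β + 1) (S : DataSet k p) {lam : ℝ} (hlam : 0 < lam) :
    IsRegMinimizer R S lam (estimator R S lam) :=
  Classical.epsilon_spec (exists_isRegMinimizer hRc hR0 hRb S hlam)

theorem continuousOn_estimator (hRc : Continuous R) (hR0 : R 0 = 0)
    (hRb : ∀ β j, |β j| ≤ R β + 1) {lmin : ℝ} (hlmin : 0 < lmin) :
    ContinuousOn (fun q : ℝ × DataSet k p => estimator R q.2 q.1)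
      {q | lmin ≤ q.1 ∧ ∃! β, IsRegMinimizer R q.2 q.1 β} := by
  have hspec : ∀ q : ℝ × DataSet k p, lmin ≤ q.1 →
      IsRegMinimizer R q.2 q.1 (estimator R q.2 q.1) := fun q hq =>
    isRegMinimizer_estimator hRc hR0 hRb q.2 (hlmin.trans_le hq)
  refine continuousOn_argmin
    (F := fun (q : ℝ × DataSet k p) β => logisticLoss β q.2 + q.1 * R β) (continuous_objective hRc)
    (isCompact_Icc (a := (fun _ => -(1 / lmin + 1) : Fin p → ℝ)) (b := fun _ => 1 / lmin + 1))
    (fun q hq => ?_) (fun q hq => hspec q hq.1)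
    (fun q hq γ hγ => hq.2.unique hγ (hspec q hq.1))
  have h1 : ∀ j, |estimator R q.2 q.1 j| ≤ 1 / lmin + 1 := fun j => by
    have h2 := (hspec q hq.1).penalty_le hR0 (hlmin.trans_le hq.1)
    have h3 : 1 / q.1 ≤ 1 / lmin := one_div_le_one_div_of_le hlmin hq.1
    linarith [hRb (estimator R q.2 q.1) j]
  exact ⟨fun j => (abs_le.1 (h1 j)).1, fun j => (abs_le.1 (h1 j)).2⟩

instance : OpensMeasurableSpace ℤˣ :=
  ⟨fun s _ => ⟨Units.val '' s, trivial, Set.preimage_image_eq s Units.val_injective⟩⟩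

/-- The estimator is continuous where the minimizer is unique, and arbitrary choices elsewhere
affect only a null set. -/
theorem aemeasurable_validationLoss {m m' : ℕ} (hRc : Continuous R) (hR0 : R 0 = 0)
    (hRb : ∀ β j, |β j| ≤ R β + 1) {lam : ℝ} (hlam : 0 < lam) (D : Measure (Instance m p m'))
    (huniq : ∀ᵐ P ∂D, ∃! β, IsRegMinimizer R P.1 lam β) :
    AEMeasurable (validationLoss R lam) D := by
  obtain ⟨A, hA, hAm, hAu⟩ := huniq.exists_measurable_mem
  have h0 : ContinuousOn (fun P : Instance m p m' => (lam, P.1)) A :=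
    (continuous_const.prodMk continuous_fst).continuousOn
  have h1 := continuousOn_estimator (k := m) hRc hR0 hRb hlam
  have h1' : ContinuousOn ((fun q : ℝ × DataSet m p => estimator R q.2 q.1) ∘
      fun P : Instance m p m' => (lam, P.1)) A := by
    apply ContinuousOn.comp h1 h0
    exact fun P hP => ⟨le_rfl, hAu P hP⟩
  have i1 : OpensMeasurableSpace (DataSet m p) := inferInstance
  have i2 : OpensMeasurableSpace (DataSet m' p) := inferInstance
  have i3 : SecondCountableTopology (DataSet m p) := inferInstance
  have i4 : OpensMeasurableSpace (Instance m p m') := Prod.opensMeasurableSpace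
  have h2 : ContinuousOn (fun P : Instance m p m' => P.2) A := continuous_snd.continuousOn
  have h3 := (continuous_logisticLoss.comp_continuousOn (h1'.prodMk h2)).aemeasurable (μ := D) hAm
  rwa [Measure.restrict_eq_self_of_ae_mem hA] at h3

end Minimizer

/-! ### Elementary properties of the two penalties. -/

section Penalties

variable {k p : ℕ}

theorem continuous_l1Penalty : Continuous (l1Penalty (p := p)) :=
  continuous_finsetSum _ fun j _ => (continuous_apply j).abs

theorem continuous_l2Penalty : Continuous (l2Penalty (p := p)) :=
  continuous_finsetSum _ fun j _ => (continuous_apply j).pow 2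

theorem l1Penalty_zero : l1Penalty (0 : Fin p → ℝ) = 0 := by simp [l1Penalty]

theorem l2Penalty_zero : l2Penalty (0 : Fin p → ℝ) = 0 := by simp [l2Penalty]

theorem l1Penalty_nonneg (β : Fin p → ℝ) : 0 ≤ l1Penalty β :=
  Finset.sum_nonneg fun _ _ => abs_nonneg _

theorem l2Penalty_nonneg (β : Fin p → ℝ) : 0 ≤ l2Penalty β :=
  Finset.sum_nonneg fun _ _ => sq_nonneg _

theorem abs_le_l1Penalty_add_one (β : Fin p → ℝ) (j : Fin p) : |β j| ≤ l1Penalty β + 1 := by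
  have : |β j| ≤ l1Penalty β :=
    Finset.single_le_sum (f := fun j => |β j|) (fun _ _ => abs_nonneg _) (Finset.mem_univ j)
  linarith

theorem abs_le_l2Penalty_add_one (β : Fin p → ℝ) (j : Fin p) : |β j| ≤ l2Penalty β + 1 := by
  have : β j ^ 2 ≤ l2Penalty β :=
    Finset.single_le_sum (f := fun j => β j ^ 2) (fun _ _ => sq_nonneg _) (Finset.mem_univ j)
  rw [← sq_abs] at this
  nlinarith [sq_nonneg (|β j| - 1)]

theorem l1Penalty_segment (u v : Fin p → ℝ) {t : ℝ} (ht0 : 0 ≤ t) (ht1 : t ≤ 1) :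
    l1Penalty ((1 - t) • u + t • v) ≤ (1 - t) * l1Penalty u + t * l1Penalty v := by
  unfold l1Penalty
  rw [Finset.mul_sum, Finset.mul_sum, ← Finset.sum_add_distrib]
  refine Finset.sum_le_sum fun j _ => ?_
  simp only [Pi.add_apply, Pi.smul_apply, smul_eq_mul]
  refine (abs_add_le _ _).trans_eq ?_
  rw [abs_mul, abs_mul, abs_of_nonneg ht0, abs_of_nonneg (sub_nonneg.2 ht1)]

theorem l2Penalty_segment (u v : Fin p → ℝ) (t : ℝ) :
    l2Penalty ((1 - t) • u + t • v) =
      (1 - t) * l2Penalty u + t * l2Penalty v - t * (1 - t) * l2Penalty (v - u) := by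
  unfold l2Penalty
  rw [Finset.mul_sum, Finset.mul_sum, Finset.mul_sum, ← Finset.sum_add_distrib,
    ← Finset.sum_sub_distrib]
  refine Finset.sum_congr rfl fun j _ => ?_
  simp only [Pi.add_apply, Pi.smul_apply, Pi.sub_apply, smul_eq_mul]
  ring

theorem abs_l1Penalty_sub_le (u v : Fin p → ℝ) :
    |l1Penalty u - l1Penalty v| ≤ l1Penalty (u - v) := by
  unfold l1Penalty
  rw [← Finset.sum_sub_distrib]
  exact (Finset.abs_sum_le_sum_abs _ _).trans
    (Finset.sum_le_sum fun j _ => abs_abs_sub_abs_le_abs_sub _ _)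

theorem abs_dotProduct_le_l1 {x : Fin p → ℝ} {B : ℝ} (hx : ∀ j, |x j| ≤ B) (v : Fin p → ℝ) :
    |x ⬝ᵥ v| ≤ B * l1Penalty v := by
  unfold l1Penalty dotProduct
  rw [Finset.mul_sum]
  refine (Finset.abs_sum_le_sum_abs _ _).trans (Finset.sum_le_sum fun j _ => ?_)
  rw [abs_mul]
  exact mul_le_mul_of_nonneg_right (hx j) (abs_nonneg _)

theorem abs_dotProduct_le_l2 (x v : Fin p → ℝ) :
    |x ⬝ᵥ v| ≤ √(l2Penalty x) * √(l2Penalty v) := by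
  rw [← Real.sqrt_mul (l2Penalty_nonneg x)]
  exact Real.abs_le_sqrt (Finset.sum_mul_sq_le_sq_mul_sq _ _ _)

end Penalties

/-! ### Lipschitz regularization path for the `ℓ₂` penalty. -/

section RidgePath

variable {k p : ℕ} {S : DataSet k p}

theorem l2_growth {lam : ℝ} {u : Fin p → ℝ} (hu : IsRegMinimizer l2Penalty S lam u)
    (v : Fin p → ℝ) :
    logisticLoss u S + lam * l2Penalty u + lam * l2Penalty (v - u) ≤
      logisticLoss v S + lam * l2Penalty v := by
  refine add_le_of_isMin_of_segment (f := fun w => logisticLoss w S + lam * l2Penalty w) hu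
    fun t ht => ?_
  have h1 := logisticLoss_segment S u v (fun _ => 0) (fun i z _ => (sigmoidSlope_pos z).le)
    ht.1.le ht.2.le
  simp only [zero_mul, Finset.sum_const_zero, mul_zero, sub_zero] at h1
  simp only [l2Penalty_segment]
  linarith

theorem l2_existsUnique {lam : ℝ} (hlam : 0 < lam) :
    ∃! β, IsRegMinimizer l2Penalty S lam β := by
  obtain ⟨u, hu⟩ := exists_isRegMinimizer continuous_l2Penalty l2Penalty_zero
    abs_le_l2Penalty_add_one S hlam
  refine ⟨u, hu, fun v hv => ?_⟩
  have h1 := l2_growth hu v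
  have h2 : lam * l2Penalty (v - u) ≤ 0 := by linarith [hv u]
  have h3 : l2Penalty (v - u) = 0 :=
    le_antisymm (nonpos_of_mul_nonpos_right h2 hlam) (l2Penalty_nonneg _)
  funext j
  have h4 := (Finset.sum_eq_zero_iff_of_nonneg fun j _ => sq_nonneg ((v - u) j)).1 h3 j
    (Finset.mem_univ j)
  have h5 : (v - u) j = 0 := by simpa using h4
  exact sub_eq_zero.1 h5

theorem l2_path_lipschitz {lmin lam lam' : ℝ} (hlmin : 0 < lmin) (hlam : lmin ≤ lam)
    (hlam' : lmin ≤ lam') {u v : Fin p → ℝ} (hu : IsRegMinimizer l2Penalty S lam u)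
    (hv : IsRegMinimizer l2Penalty S lam' v) :
    √(l2Penalty (u - v)) ≤ √(4 / lmin) / (2 * lmin) * |lam - lam'| := by
  set r := √(l2Penalty (u - v)) with hr
  have hr0 : 0 ≤ r := Real.sqrt_nonneg _
  have hr2 : l2Penalty (u - v) = r ^ 2 := (Real.sq_sqrt (l2Penalty_nonneg _)).symm
  have hsymm : l2Penalty (v - u) = r ^ 2 := by
    rw [← hr2]
    exact Finset.sum_congr rfl fun j _ => by simp only [Pi.sub_apply]; ring
  have h1 := l2_growth hu v
  have h2 := l2_growth hv u
  rw [hsymm] at h1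
  rw [hr2] at h2
  have hbound : ∀ {l : ℝ} {w : Fin p → ℝ}, lmin ≤ l → IsRegMinimizer l2Penalty S l w →
      l2Penalty w ≤ 1 / lmin := fun hl hw =>
    (hw.penalty_le l2Penalty_zero (hlmin.trans_le hl)).trans (one_div_le_one_div_of_le hlmin hl)
  -- By the parallelogram law; it controls `R(u) - R(v) = ⟨u + v, u - v⟩` through Cauchy–Schwarz.
  have hsum : l2Penalty (u + v) ≤ 4 / lmin := by
    have e : l2Penalty (u + v) + l2Penalty (u - v) = 2 * l2Penalty u + 2 * l2Penalty v := by
      unfold l2Penalty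
      rw [Finset.mul_sum, Finset.mul_sum, ← Finset.sum_add_distrib, ← Finset.sum_add_distrib]
      exact Finset.sum_congr rfl fun j _ => by simp only [Pi.sub_apply, Pi.add_apply]; ring
    have e4 : 4 / lmin = 4 * (1 / lmin) := by ring
    linarith [l2Penalty_nonneg (u - v), hbound hlam hu, hbound hlam' hv]
  have hdiff : |l2Penalty u - l2Penalty v| ≤ √(4 / lmin) * r := by
    have e : l2Penalty u - l2Penalty v = (u + v) ⬝ᵥ (u - v) := by
      unfold l2Penalty dotProduct
      rw [← Finset.sum_sub_distrib]
      exact Finset.sum_congr rfl fun j _ => by simp only [Pi.sub_apply, Pi.add_apply]; ring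
    rw [e]
    exact (abs_dotProduct_le_l2 _ _).trans
      (mul_le_mul_of_nonneg_right (Real.sqrt_le_sqrt hsum) hr0)
  have hmain : 2 * lmin * r ^ 2 ≤ |lam - lam'| * (√(4 / lmin) * r) := by
    calc 2 * lmin * r ^ 2 ≤ (lam + lam') * r ^ 2 := by gcongr; linarith
      _ ≤ -((lam - lam') * (l2Penalty u - l2Penalty v)) := by linarith
      _ ≤ |lam - lam'| * |l2Penalty u - l2Penalty v| := by
          rw [← abs_mul]; exact neg_le_abs _
      _ ≤ _ := by gcongr
  rcases hr0.eq_or_lt with h | h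
  · rw [← h]; positivity
  · have h3 : r * (2 * lmin) ≤ √(4 / lmin) * |lam - lam'| :=
      le_of_mul_le_mul_right (by linarith) h
    rw [div_mul_eq_mul_div, le_div_iff₀ (by positivity)]
    exact h3

end RidgePath

/-! ### Locally Lipschitz regularization path for the `ℓ₁` penalty. -/

section LassoPath

variable {k p : ℕ} {S : DataSet k p}

theorem l1_growth {lam c : ℝ} (hlam : 0 ≤ lam) {u v : Fin p → ℝ} {μ : Fin k → ℝ}
    (hμ : ∀ i, ∀ z ∈ Set.uIcc (S.1 i ⬝ᵥ u) (S.1 i ⬝ᵥ v), μ i ≤ sigmoidSlope z)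
    (hc : 2 * c ≤ (1 / (k : ℝ)) * ∑ i, μ i * (S.1 i ⬝ᵥ (v - u)) ^ 2)
    (hu : IsRegMinimizer l1Penalty S lam u) :
    logisticLoss u S + lam * l1Penalty u + c ≤ logisticLoss v S + lam * l1Penalty v := by
  refine add_le_of_isMin_of_segment (f := fun w => logisticLoss w S + lam * l1Penalty w) hu
    fun t ht => ?_
  have h1 := logisticLoss_segment S u v μ hμ ht.1.le ht.2.le
  have h2 := mul_le_mul_of_nonneg_left (l1Penalty_segment u v ht.1.le ht.2.le) hlam
  have h3 := mul_le_mul_of_nonneg_left hc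
    (show 0 ≤ t * (1 - t) / 2 from div_nonneg (mul_nonneg ht.1.le (sub_nonneg.2 ht.2.le)) two_pos.le)
  linarith

/-- Two `ℓ₁` minimizers are close if the second one has the larger support and a Hessian which
controls the curvature of the loss on the segment between them. -/
theorem l1_path_bound {lam lam' κ : ℝ} (hlam : 0 ≤ lam) (hlam' : 0 ≤ lam') (hκ : 0 < κ)
    {u v : Fin p → ℝ} (hu : IsRegMinimizer l1Penalty S lam u)
    (hv : IsRegMinimizer l1Penalty S lam' v)
    (hcurv : ∀ i, ∀ z ∈ Set.uIcc (S.1 i ⬝ᵥ u) (S.1 i ⬝ᵥ v),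
      1 / 2 * sigmoidSlope (S.1 i ⬝ᵥ v) ≤ sigmoidSlope z)
    (hsupp : ∀ j, v j = 0 → u j = 0)
    (hess : ∀ w : Fin p → ℝ, (∀ j, v j = 0 → w j = 0) →
      κ * (w ⬝ᵥ w) ≤ w ⬝ᵥ (logisticHessian v S).mulVec w) :
    l1Penalty (v - u) ≤ 2 / κ * k * |lam' - lam| := by
  set Δ := v - u with hΔ
  have hΔ0 : ∀ j, v j = 0 → Δ j = 0 := fun j hj => by simp [hΔ, hj, hsupp j hj]
  set q := Δ ⬝ᵥ Δ with hq
  -- One factor 1/2 is lost to `hcurv`, the other is the 1/2 of second-order growth.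
  set c := κ / 4 * q with hc
  have hH := hess Δ hΔ0
  rw [dotProduct_logisticHessian_mulVec] at hH
  have e : (1 / (k : ℝ)) * ∑ i, 1 / 2 * sigmoidSlope (S.1 i ⬝ᵥ v) * (S.1 i ⬝ᵥ Δ) ^ 2 =
      1 / 2 * ((1 / (k : ℝ)) * ∑ i, sigmoidSlope (S.1 i ⬝ᵥ v) * (S.1 i ⬝ᵥ Δ) ^ 2) := by
    simp_rw [mul_assoc (1 / 2 : ℝ)]
    rw [← Finset.mul_sum]
    ring
  have hc1 : 2 * c ≤ (1 / (k : ℝ)) *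
      ∑ i, 1 / 2 * sigmoidSlope (S.1 i ⬝ᵥ v) * (S.1 i ⬝ᵥ Δ) ^ 2 := by
    rw [e, hc]; linarith
  have hc2 : 2 * c ≤ (1 / (k : ℝ)) *
      ∑ i, 1 / 2 * sigmoidSlope (S.1 i ⬝ᵥ v) * (S.1 i ⬝ᵥ (u - v)) ^ 2 := by
    have : ∀ i, (S.1 i ⬝ᵥ (u - v)) ^ 2 = (S.1 i ⬝ᵥ Δ) ^ 2 := fun i => by
      rw [hΔ, dotProduct_sub, dotProduct_sub]; ring
    simp_rw [this]
    exact hc1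
  have h1 := l1_growth hlam hcurv hc1 hu
  have h2 := l1_growth hlam' (fun i z hz => hcurv i z (by rwa [Set.uIcc_comm])) hc2 hv
  set r := l1Penalty Δ with hr
  have hr0 : 0 ≤ r := l1Penalty_nonneg _
  have h3 : κ / 2 * q ≤ |lam' - lam| * r := by
    calc κ / 2 * q = c + c := by rw [hc]; ring
      _ ≤ -((lam' - lam) * (l1Penalty v - l1Penalty u)) := by linarith
      _ ≤ |lam' - lam| * |l1Penalty v - l1Penalty u| := by
          rw [← abs_mul]; exact neg_le_abs _
      _ ≤ |lam' - lam| * r := by gcongr; exact abs_l1Penalty_sub_le v u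
  set A := Finset.univ.filter fun j => v j ≠ 0 with hA
  have hcard : A.card ≤ k := card_le_of_logisticHessian_pos S v A hκ fun w hw =>
    hess w fun j hj => hw j (by simp [hA, hj])
  have hrq : r ^ 2 ≤ k * q := by
    have e1 : r = ∑ j ∈ A, |Δ j| := by
      rw [hr, l1Penalty]
      refine (Finset.sum_subset (Finset.subset_univ A) fun j _ hj => ?_).symm
      rw [hΔ0 j (by simpa [hA] using hj), abs_zero]
    have e2 : ∑ j ∈ A, |Δ j| ^ 2 ≤ q := by
      rw [hq, dotProduct]
      refine (Finset.sum_le_univ_sum_of_nonneg fun j => sq_nonneg _).trans_eq ?_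
      exact Finset.sum_congr rfl fun j _ => by rw [sq_abs, sq]
    have hcard' : (A.card : ℝ) ≤ k := by exact_mod_cast hcard
    rw [e1]
    exact sq_sum_le_card_mul_sum_sq.trans
      (mul_le_mul hcard' e2 (Finset.sum_nonneg fun _ _ => sq_nonneg _) (Nat.cast_nonneg k))
  rcases hr0.eq_or_lt with h | h
  · rw [← h]; positivity
  · have h4 : κ * r ^ 2 ≤ 2 * k * |lam' - lam| * r := by
      calc κ * r ^ 2 ≤ κ * (k * q) := by gcongr
        _ = 2 * k * (κ / 2 * q) := by ring
        _ ≤ 2 * k * (|lam' - lam| * r) := by gcongr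
        _ = _ := by ring
    have h5 : κ * r ≤ 2 * k * |lam' - lam| := le_of_mul_le_mul_right (by linarith) h
    rw [show 2 / κ * k * |lam' - lam| = (2 * k * |lam' - lam|) / κ by ring, le_div_iff₀ hκ]
    linarith

theorem l1_path_locally_lipschitz {lmin lmax κ : ℝ} (hlmin : 0 < lmin) (hκ : 0 < κ)
    (hS : L1Nondegenerate S lmin lmax κ) {lam : ℝ} (hlam : lam ∈ Set.Icc lmin lmax) :
    ∀ᶠ lam' in nhdsWithin lam (Set.Icc lmin lmax),
      l1Penalty (estimator l1Penalty S lam' - estimator l1Penalty S lam) ≤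
        2 / κ * k * |lam' - lam| := by
  have hspec : ∀ l ∈ Set.Icc lmin lmax, IsRegMinimizer l1Penalty S l (estimator l1Penalty S l) :=
    fun l hl => isRegMinimizer_estimator continuous_l1Penalty l1Penalty_zero
      abs_le_l1Penalty_add_one S (hlmin.trans_le hl.1)
  have h1 := continuousOn_estimator (k := k) (p := p) continuous_l1Penalty l1Penalty_zero
    abs_le_l1Penalty_add_one hlmin
  have h0 : ContinuousOn (fun l : ℝ => (l, S)) (Set.Icc lmin lmax) :=
    (continuous_id.prodMk continuous_const).continuousOn
  have hcont : ContinuousOn ((fun q : ℝ × DataSet k p => estimator l1Penalty q.2 q.1) ∘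
      fun l : ℝ => (l, S)) (Set.Icc lmin lmax) := by
    apply ContinuousOn.comp h1 h0
    exact fun l hl => ⟨hl.1, (hS l hl).1⟩
  have ht : Filter.Tendsto (fun l => estimator l1Penalty S l)
      (nhdsWithin lam (Set.Icc lmin lmax)) (nhds (estimator l1Penalty S lam)) := hcont lam hlam
  have hcurv : ∀ i, ∀ᶠ v in nhds (estimator l1Penalty S lam),
      ∀ z ∈ Set.uIcc (S.1 i ⬝ᵥ estimator l1Penalty S lam) (S.1 i ⬝ᵥ v),
        1 / 2 * sigmoidSlope (S.1 i ⬝ᵥ v) ≤ sigmoidSlope z := fun i => by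
    have hd : Continuous fun v : Fin p → ℝ => S.1 i ⬝ᵥ v :=
      Continuous.dotProduct continuous_const continuous_id
    exact hd.continuousAt.eventually (eventually_sigmoidSlope_ge _)
  -- Nonzero coordinates persist under small perturbation. New ones may appear, which is why the
  -- Hessian is taken at the nearby minimizer, whose support contains both.
  have hsupp : ∀ j, ∀ᶠ v in nhds (estimator l1Penalty S lam),
      v j = 0 → estimator l1Penalty S lam j = 0 := fun j => by
    by_cases hj : estimator l1Penalty S lam j = 0
    · exact Filter.Eventually.of_forall fun _ _ => hj
    · filter_upwards [(continuous_apply j).continuousAt.eventually_ne hj] with v hv h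
      exact absurd h hv
  filter_upwards [ht.eventually (Filter.eventually_all.2 hcurv),
    ht.eventually (Filter.eventually_all.2 hsupp), self_mem_nhdsWithin] with l hl1 hl2 hl
  exact l1_path_bound (hlmin.le.trans hlam.1) (hlmin.le.trans hl.1) hκ (hspec lam hlam)
    (hspec l hl) hl1 hl2 ((hS l hl).2 _ (hspec l hl))

end LassoPath

/-! ### From pointwise local bounds to a Lipschitz bound on an interval. -/

theorem lipschitz_of_locally_lipschitz {f : ℝ → ℝ} {a b L : ℝ}
    (h : ∀ z ∈ Set.Icc a b, ∀ᶠ w in nhdsWithin z (Set.Icc a b), |f w - f z| ≤ L * |w - z|)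
    {z w : ℝ} (hz : z ∈ Set.Icc a b) (hw : w ∈ Set.Icc a b) : |f z - f w| ≤ L * |z - w| := by
  have hcont : ContinuousOn f (Set.Icc a b) := fun z hz => by
    refine tendsto_iff_dist_tendsto_zero.2 (squeeze_zero' (Filter.Eventually.of_forall
      fun _ => dist_nonneg) (h z hz) ?_)
    have : Filter.Tendsto (fun w => L * |w - z|) (nhds z) (nhds (L * |z - z|)) :=
      (continuous_const.mul (continuous_id.sub continuous_const).abs).tendsto z
    rw [sub_self, abs_zero, mul_zero] at this
    exact this.mono_left nhdsWithin_le_nhds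
  have key : ∀ z ∈ Set.Icc a b, ∀ w ∈ Set.Icc a b, z ≤ w → |f w - f z| ≤ L * (w - z) := by
    intro z hz w hw hzw
    have hsub : Set.Icc z w ⊆ Set.Icc a b := Set.Icc_subset_Icc hz.1 hw.2
    have hc : IsClosed ({t | |f t - f z| ≤ L * (t - z)} ∩ Set.Icc z w) := by
      have := isClosed_Icc.isClosed_le (((hcont.mono hsub).sub continuousOn_const).abs)
        (f := fun t => |f t - f z|) (g := fun t => L * (t - z))
        (continuous_const.mul (continuous_id.sub continuous_const)).continuousOn
      convert this using 1
      ext t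
      exact and_comm
    -- Continuous induction: the set of `t` satisfying the bound from `z` is closed, and the local
    -- bound pushes it to the right.
    refine hc.Icc_subset_of_forall_exists_gt (by simp) (fun x hx y hy => ?_) ⟨hzw, le_rfl⟩
    have hxI : x ∈ Set.Icc a b := hsub ⟨hx.2.1, hx.2.2.le⟩
    have hxw : x < min y w := lt_min hy hx.2.2
    have h1 : ∀ᶠ t in nhdsWithin x (Set.Ioi x), |f t - f x| ≤ L * |t - x| := by
      have h2 : ∀ᶠ t in nhdsWithin x (Set.Ioc x w), |f t - f x| ≤ L * |t - x| :=
        nhdsWithin_mono x (fun t ht => hsub ⟨hx.2.1.trans ht.1.le, ht.2⟩) (h x hxI)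
      rwa [nhdsWithin_Ioc_eq_nhdsGT hx.2.2] at h2
    obtain ⟨t, ht, htm⟩ := (h1.and (Ioc_mem_nhdsGT hxw)).exists
    refine ⟨t, ?_, htm.1, htm.2.trans (min_le_left _ _)⟩
    have h3 : |f x - f z| ≤ L * (x - z) := hx.1
    rw [abs_of_pos (sub_pos.2 htm.1)] at ht
    have h4 := abs_sub_le (f t) (f x) (f z)
    change |f t - f z| ≤ L * (t - z)
    linarith
  rcases le_total z w with hle | hle
  · rw [abs_sub_comm, abs_sub_comm z, abs_of_nonneg (sub_nonneg.2 hle)]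
    exact key z hz w hw hle
  · rw [abs_of_nonneg (sub_nonneg.2 hle)]
    exact key w hw z hz hle

/-! ### Lipschitz validation losses and the resulting bounds. -/

section ValidationLoss

variable {m p m' : ℕ} {P : Instance m p m'} {lmin lmax : ℝ}

theorem validationLoss_l2_lipschitz (hm' : 0 < m') (hlmin : 0 < lmin) {B : ℝ}
    (hB : ∀ i, √(∑ j, P.2.1 i j ^ 2) ≤ B) {z w : ℝ} (hz : z ∈ Set.Icc lmin lmax)
    (hw : w ∈ Set.Icc lmin lmax) :
    |validationLoss l2Penalty z P - validationLoss l2Penalty w P| ≤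
      |B| * (√(4 / lmin) / (2 * lmin)) * |z - w| := by
  have hspec : ∀ l ∈ Set.Icc lmin lmax,
      IsRegMinimizer l2Penalty P.1 l (estimator l2Penalty P.1 l) :=
    fun l hl => isRegMinimizer_estimator continuous_l2Penalty l2Penalty_zero
      abs_le_l2Penalty_add_one P.1 (hlmin.trans_le hl.1)
  refine abs_logisticLoss_sub_le hm' _ _ _ fun i => ?_
  rw [mul_assoc]
  refine (abs_dotProduct_le_l2 _ _).trans (mul_le_mul ((hB i).trans (le_abs_self B))
    (l2_path_lipschitz hlmin hz.1 hw.1 (hspec z hz) (hspec w hw)) (Real.sqrt_nonneg _)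
    (abs_nonneg B))

theorem validationLoss_l1_lipschitz (hm' : 0 < m') (hlmin : 0 < lmin) {B κ : ℝ} (hκ : 0 < κ)
    (hB : ∀ i j, |P.2.1 i j| ≤ B) (hP : L1Nondegenerate P.1 lmin lmax κ)
    {z w : ℝ} (hz : z ∈ Set.Icc lmin lmax) (hw : w ∈ Set.Icc lmin lmax) :
    |validationLoss l1Penalty z P - validationLoss l1Penalty w P| ≤
      |B| * (2 / κ) * m * |z - w| := by
  refine lipschitz_of_locally_lipschitz (f := fun l => validationLoss l1Penalty l P)
    (fun l hl => ?_) hz hw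
  filter_upwards [l1_path_locally_lipschitz hlmin hκ hP hl] with l' hl'
  refine abs_logisticLoss_sub_le hm' _ _ _ fun i => ?_
  refine (abs_dotProduct_le_l1 (fun j => (hB i j).trans (le_abs_self B)) _).trans ?_
  refine (mul_le_mul_of_nonneg_left hl' (abs_nonneg B)).trans_eq ?_
  ring

theorem rademacher_validationLossClass_le {R : (Fin p → ℝ) → ℝ} (hRc : Continuous R) (hR0 : R 0 = 0)
    (hRb : ∀ β j, |β j| ≤ R β + 1) (hlmin : 0 < lmin) (hl : lmin ≤ lmax) {H c : ℝ}
    (hm : 0 < m) (hc : 0 ≤ c) (D : Measure (Instance m p m')) [IsProbabilityMeasure D]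
    (hH : ∀ᵐ P ∂D, ∀ lam ∈ Set.Icc lmin lmax, validationLoss R lam P ≤ H)
    (huniq : ∀ᵐ P ∂D, ∀ lam ∈ Set.Icc lmin lmax, ∃! β, IsRegMinimizer R P.1 lam β)
    (hlip : ∀ᵐ P ∂D, ∀ z ∈ Set.Icc lmin lmax, ∀ w ∈ Set.Icc lmin lmax,
      |validationLoss R z P - validationLoss R w P| ≤ c * m * |z - w|)
    {n : ℕ} (hn : 0 < n) :
    AEMeasurable (fun x : Fin n → Instance m p m' =>
      empiricalRademacher (validationLossClass m p m' R lmin lmax) x) (Measure.pi fun _ => D) ∧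
    ∀ ε : ℝ, 0 < ε → ε < 1 / (4 + 2 * c * (lmax - lmin)) →
      rademacherComplexity (validationLossClass m p m' R lmin lmax) D n ≤
        ENNReal.ofReal ((3 * (|H| + 1) + 1) *
          (√(((m : ℝ) ^ 2 + Real.log (1 / ε)) / (n : ℝ)) + ε ^ 2)) := by
  constructor
  · refine aemeasurable_empiricalRademacher D (validationLoss R) (fun z hz => ?_) ?_ n
    · exact aemeasurable_validationLoss hRc hR0 hRb (hlmin.trans_le hz.1) D
        (huniq.mono fun P hP => hP z hz)
    · filter_upwards [hlip] with P hP
      have : LipschitzOnWith (Real.toNNReal (c * m)) (fun z => validationLoss R z P)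
          (Set.Icc lmin lmax) := LipschitzOnWith.of_dist_le_mul fun z hz w hw => by
        rw [Real.coe_toNNReal _ (by positivity)]
        exact hP z hz w hw
      exact this.continuousOn
  · intro ε hε hε'
    refine rademacherComplexity_le_of_lipschitz D hl (validationLoss R) hm
      (by positivity) hc ?_ hlip hn hε hε'
    filter_upwards [hH] with P hP z hz
    have h0 : 0 ≤ validationLoss R z P := logisticLoss_nonneg _ _
    rw [abs_of_nonneg h0]
    linarith [hP z hz, le_abs_self H]

end ValidationLoss

theorem threshold_mem_Ioc {x : ℝ} (hx : 0 ≤ x) : 1 / (4 + x) ∈ Set.Ioc (0 : ℝ) 1 :=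
  ⟨by positivity, by rw [div_le_one (by positivity)]; linarith⟩

end RegLogistic

theorem mainTheorem12 (lmin lmax H : ℝ) (hlmin : 0 < lmin) (hl : lmin ≤ lmax) :
    -- `ℓ₂` regularization
    (∃ C : ℝ, 0 < C ∧ ∀ B : ℝ, ∃ ε₀ ∈ Set.Ioc (0 : ℝ) 1,
      ∀ (m p m' : ℕ), 0 < m → 0 < m' →
      ∀ (D : Measure (RegLogistic.Instance m p m')) [IsProbabilityMeasure D],
        (∀ᵐ P ∂D, ∀ lam ∈ Set.Icc lmin lmax,
          RegLogistic.validationLoss RegLogistic.l2Penalty lam P ≤ H) →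
        (∀ᵐ P ∂D, ∀ i, √(∑ j, P.2.1 i j ^ 2) ≤ B) →
        ∀ n : ℕ, 0 < n →
          AEMeasurable
            (fun x : Fin n → RegLogistic.Instance m p m' =>
              RegLogistic.empiricalRademacher
                (RegLogistic.validationLossClass m p m' RegLogistic.l2Penalty lmin lmax) x)
            (Measure.pi fun _ => D) ∧
          ∀ ε : ℝ, 0 < ε → ε < ε₀ →
            RegLogistic.rademacherComplexity
                (RegLogistic.validationLossClass m p m' RegLogistic.l2Penalty lmin lmax) D n ≤
              ENNReal.ofReal
                (C * (√(((m : ℝ) ^ 2 + Real.log (1 / ε)) / (n : ℝ)) + ε ^ 2))) ∧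
    -- `ℓ₁` regularization
    (∃ C : ℝ, 0 < C ∧ ∀ B κ : ℝ, 0 < κ → ∃ ε₀ ∈ Set.Ioc (0 : ℝ) 1,
      ∀ (m p m' : ℕ), 0 < m → 0 < m' →
      ∀ (D : Measure (RegLogistic.Instance m p m')) [IsProbabilityMeasure D],
        (∀ᵐ P ∂D, ∀ lam ∈ Set.Icc lmin lmax,
          RegLogistic.validationLoss RegLogistic.l1Penalty lam P ≤ H) →
        (∀ᵐ P ∂D, ∀ i j, |P.2.1 i j| ≤ B) →
        (∀ᵐ P ∂D, RegLogistic.L1Nondegenerate P.1 lmin lmax κ) →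
        ∀ n : ℕ, 0 < n →
          AEMeasurable
            (fun x : Fin n → RegLogistic.Instance m p m' =>
              RegLogistic.empiricalRademacher
                (RegLogistic.validationLossClass m p m' RegLogistic.l1Penalty lmin lmax) x)
            (Measure.pi fun _ => D) ∧
          ∀ ε : ℝ, 0 < ε → ε < ε₀ →
            RegLogistic.rademacherComplexity
                (RegLogistic.validationLossClass m p m' RegLogistic.l1Penalty lmin lmax) D n ≤
              ENNReal.ofReal
                (C * (√(((m : ℝ) ^ 2 + Real.log (1 / ε)) / (n : ℝ)) + ε ^ 2))) := by
  have hW : 0 ≤ lmax - lmin := sub_nonneg.2 hl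
  refine ⟨⟨3 * (|H| + 1) + 1, by positivity, fun B => ?_⟩,
    ⟨3 * (|H| + 1) + 1, by positivity, fun B κ hκ => ?_⟩⟩
  · set c := |B| * (√(4 / lmin) / (2 * lmin)) with hc
    have hc0 : 0 ≤ c := by positivity
    refine ⟨1 / (4 + 2 * c * (lmax - lmin)), RegLogistic.threshold_mem_Ioc (by positivity), ?_⟩
    intro m p m' hm hm' D _ hH hB n hn
    refine RegLogistic.rademacher_validationLossClass_le RegLogistic.continuous_l2Penalty RegLogistic.l2Penalty_zero
      RegLogistic.abs_le_l2Penalty_add_one hlmin hl hm hc0 D hH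
      (Filter.Eventually.of_forall fun P lam hlam => RegLogistic.l2_existsUnique (hlmin.trans_le hlam.1)) ?_ hn
    filter_upwards [hB] with P hP z hz w hw
    refine (RegLogistic.validationLoss_l2_lipschitz hm' hlmin hP hz hw).trans ?_
    -- The `ℓ₂` Lipschitz constant is free of `m`; it is weakened to fit the common form `c * m`.
    have hm1 : (1 : ℝ) ≤ m := by exact_mod_cast hm
    exact mul_le_mul_of_nonneg_right (le_mul_of_one_le_right hc0 hm1) (abs_nonneg _)
  · have hc0 : 0 ≤ |B| * (2 / κ) := by positivity
    refine ⟨1 / (4 + 2 * (|B| * (2 / κ)) * (lmax - lmin)), RegLogistic.threshold_mem_Ioc (by positivity), ?_⟩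
    intro m p m' hm hm' D _ hH hB hP n hn
    refine RegLogistic.rademacher_validationLossClass_le RegLogistic.continuous_l1Penalty RegLogistic.l1Penalty_zero
      RegLogistic.abs_le_l1Penalty_add_one hlmin hl hm hc0 D hH
      (hP.mono fun P h lam hlam => (h lam hlam).1) ?_ hn
    filter_upwards [hB, hP] with P hPB hPN z hz w hw
    exact RegLogistic.validationLoss_l1_lipschitz hm' hlmin hκ hPB hPN hz hw
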